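/- \textbf{Theorem (Cauchy--Pompeiu formula).} Let $\Omega\subset\mathbb{C}$ be an open set with compact closure, let $u\colon\Omega\to\mathbb{C}$ be smooth (i.e. $C^\infty$ in the real variables $x,y$, $z=x+iy$), and let $\omega\subset\Omega$ be an open set with smooth boundary such that $\partial\omega\subset\Omega$. (Smooth boundary means: every $p\in\partial\omega$ has an open neighbourhood $U$ with a smooth $\rho\colon U\to\mathbb{R}$ such that $\rho(p)=0$, $d\rho(p)\neq 0$ and $\omega\cap U=\{z\in U:\rho(z)<0\}$.) Write $\partial_{z^*}u=\tfrac12(\partial_x u+i\,\partial_y u)$, $dz=dx+i\,dy$, $dz^*=dx-i\,dy$, and give $\partial\omega$ its boundary orientation ($\omega$ on the left), so that $\int_{\partial\omega}f\,dz=\int_{\partial\omega}f\,\tau\,ds$, where $\tau$ is the positively oriented unit tangent ($i$ times the outward unit normal) and $ds$ is arc length, i.e. one-dimensional Hausdorff measure. Then for every $\lambda\in\omega$ the integrals below converge absolutely and \begin{align*} u(\lambda)&=\frac{1}{2\pi i}\int_{\partial\omega}\frac{u(z)}{z-\lambda}\,dz-\frac{1}{2\pi i}\int_{\omega}\frac{\partial_{z^*}u(z)}{z-\lambda}\,dz^*\wedge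 dz\\ &=\frac{1}{2\pi i}\int_{\partial\omega}\frac{u(z)}{z-\lambda}\,dz-\frac{1}{\pi}\int_{\omega}\frac{\partial_{z^*}u(z)}{z-\lambda}\,dx\,dy . \end{align*} -/

import Mathlib

open MeasureTheory Set Filter Topology
open scoped ContDiff

/-- `ρ` is a smooth local defining function of the open set `D` near `p`: on some open neighbourhood
`U` of `p` it is smooth, `D ∩ U = {z ∈ U | ρ z < 0}`, and `ρ p = 0`, `dρ(p) ≠ 0`. -/
def IsLocalDefiningFunction (D : Set ℂ) (p : ℂ) (ρ : ℂ → ℝ) : Prop :=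
  ∃ U : Set ℂ, IsOpen U ∧ p ∈ U ∧ ContDiffOn ℝ ∞ ρ U ∧ ρ p = 0 ∧ fderiv ℝ ρ p ≠ 0 ∧
    ∀ z ∈ U, z ∈ D ↔ ρ z < 0

/-- `D` has smooth boundary: near each boundary point, `D` is the negative side of the regular zero
set of a smooth function (so `closure D` is a smooth 2-manifold with boundary `frontier D`). -/
def HasSmoothBoundary (D : Set ℂ) : Prop :=
  ∀ p ∈ frontier D, ∃ ρ : ℂ → ℝ, IsLocalDefiningFunction D p ρ

open Classical in
/-- The outward unit normal `∇ρ / |∇ρ|` of `D` at `p`, where `ρ` is any local defining function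
(see `outwardUnitNormal_eq` for the independence of `ρ`); zero if there is none. -/
noncomputable def outwardUnitNormal (D : Set ℂ) (p : ℂ) : ℂ :=
  if h : ∃ ρ : ℂ → ℝ, IsLocalDefiningFunction D p ρ then
    ‖gradient h.choose p‖⁻¹ • gradient h.choose p
  else 0

/-- The unit tangent to the boundary of `D` in the boundary orientation (`D` on the left):
the outward unit normal turned counterclockwise by a right angle. -/
noncomputable def positiveUnitTangent (D : Set ℂ) (p : ℂ) : ℂ :=
  Complex.I * outwardUnitNormal D p

/-- The integral of a complex-valued 1-form `α` over the boundary of `D`, with the boundary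
orientation: `α` applied to the positive unit tangent, integrated against arc length, i.e. the
one-dimensional Hausdorff measure (equal to Lebesgue measure on the real line). -/
noncomputable def boundaryIntegral (D : Set ℂ) (α : ℂ → (ℂ →L[ℝ] ℂ)) : ℂ :=
  ∫ z in frontier D, α z (positiveUnitTangent D z) ∂(Measure.hausdorffMeasure 1 : Measure ℂ)

/-- The 1-form `dz = dx + i dy`. -/
noncomputable def formDz : ℂ →L[ℝ] ℂ := ContinuousLinearMap.id ℝ ℂ

/-- The 1-form `dz* = dx - i dy`. -/
noncomputable def formDzStar : ℂ →L[ℝ] ℂ := (Complex.conjCLE : ℂ →L[ℝ] ℂ)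

/-- The wedge product of two 1-forms (at a point), as a function of two tangent vectors. -/
noncomputable def wedgeProd (α β : ℂ →L[ℝ] ℂ) (v w : ℂ) : ℂ := α v * β w - α w * β v

/-- The integral over `D` of a complex-valued 2-form: its value on the oriented orthonormal frame
`(∂_x, ∂_y) = (1, i)`, integrated against Lebesgue measure. -/
noncomputable def areaIntegral (D : Set ℂ) (φ : ℂ → ℂ → ℂ → ℂ) : ℂ :=
  ∫ z in D, φ z 1 Complex.I

/-- The Wirtinger derivative `∂_{z*} u = (∂_x u + i ∂_y u) / 2`. -/
noncomputable def dzStarDeriv (u : ℂ → ℂ) (z : ℂ) : ℂ :=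
  (fderiv ℝ u z 1 + Complex.I * fderiv ℝ u z Complex.I) / 2

theorem IsLocalDefiningFunction.gradient_ne_zero {D : Set ℂ} {p : ℂ} {ρ : ℂ → ℝ}
    (h : IsLocalDefiningFunction D p ρ) : gradient ρ p ≠ 0 := by
  obtain ⟨U, -, -, -, -, h, -⟩ := h
  simpa [gradient] using h

/-- The derivative of a local defining function along a line through `p`. -/
theorem IsLocalDefiningFunction.hasDerivAt {D : Set ℂ} {p : ℂ} {ρ : ℂ → ℝ}
    (h : IsLocalDefiningFunction D p ρ) (v : ℂ) :
    HasDerivAt (fun t : ℝ => ρ (p + t • v)) (inner ℝ (gradient ρ p) v) 0 := by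
  obtain ⟨U, hU, hp, hs, -, -, -⟩ := h
  have hd : DifferentiableAt ℝ ρ p :=
    (hs.contDiffAt (hU.mem_nhds hp)).differentiableAt (by simp)
  have hd' : HasFDerivAt ρ (fderiv ℝ ρ p) (p + (0 : ℝ) • v) := by simpa using hd.hasFDerivAt
  have hl : HasDerivAt (fun t : ℝ => p + t • v) v 0 := by
    simpa using ((hasDerivAt_id (0 : ℝ)).smul_const v).const_add p
  have := hd'.comp_hasDerivAt (0 : ℝ) hl
  simpa [gradient, Function.comp_def] using this

/-- The normalized gradient does not depend on the local defining function. -/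
theorem IsLocalDefiningFunction.normalized_gradient_eq {D : Set ℂ} {p : ℂ} {ρ σ : ℂ → ℝ}
    (hρ : IsLocalDefiningFunction D p ρ) (hσ : IsLocalDefiningFunction D p σ) :
    ‖gradient ρ p‖⁻¹ • gradient ρ p = ‖gradient σ p‖⁻¹ • gradient σ p := by
  have ha := hρ.gradient_ne_zero
  have hb := hσ.gradient_ne_zero
  by_contra hne
  set a := gradient ρ p with ha'
  set b := gradient σ p with hb'
  set v : ℂ := ‖b‖⁻¹ • b - ‖a‖⁻¹ • a with hv
  have hna : ‖‖a‖⁻¹ • a‖ = 1 := by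
    rw [norm_smul, norm_inv, norm_norm, inv_mul_cancel₀ (norm_ne_zero_iff.2 ha)]
  have hnb : ‖‖b‖⁻¹ • b‖ = 1 := by
    rw [norm_smul, norm_inv, norm_norm, inv_mul_cancel₀ (norm_ne_zero_iff.2 hb)]
  have hlt : inner ℝ (‖a‖⁻¹ • a) (‖b‖⁻¹ • b) < 1 :=
    (inner_lt_one_iff_real_of_norm_eq_one hna hnb).2 hne
  have hav : inner ℝ a v < 0 := by
    have h1 : inner ℝ (‖a‖⁻¹ • a) v < 0 := by
      rw [hv, inner_sub_right, real_inner_self_eq_norm_sq, hna]; linarith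
    rw [real_inner_smul_left] at h1
    exact (pos_iff_neg_of_mul_neg h1).1 (by positivity)
  have hbv : 0 < inner ℝ b v := by
    have h1 : 0 < inner ℝ (‖b‖⁻¹ • b) v := by
      rw [hv, inner_sub_right, real_inner_self_eq_norm_sq, hnb, real_inner_comm]; linarith
    rw [real_inner_smul_left] at h1
    exact (pos_iff_pos_of_mul_pos h1).1 (by positivity)
  have h1 := (hasDerivAt_iff_tendsto_slope.1 (hρ.hasDerivAt v)).mono_left
    (nhdsWithin_mono (0 : ℝ) (fun x hx => ne_of_gt hx : Ioi (0 : ℝ) ⊆ {0}ᶜ))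
  have h2 := (hasDerivAt_iff_tendsto_slope.1 (hσ.hasDerivAt v)).mono_left
    (nhdsWithin_mono (0 : ℝ) (fun x hx => ne_of_gt hx : Ioi (0 : ℝ) ⊆ {0}ᶜ))
  obtain ⟨U, hU, hpU, -, hρ0, -, hUD⟩ := hρ
  obtain ⟨V, hV, hpV, -, hσ0, -, hVD⟩ := hσ
  have hc : Tendsto (fun t : ℝ => p + t • v) (𝓝[>] 0) (𝓝 p) := by
    have : Continuous (fun t : ℝ => p + t • v) := by fun_prop
    simpa using (this.tendsto 0).mono_left nhdsWithin_le_nhds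
  obtain ⟨t, ht1, ht2, htU, htV, ht⟩ := ((h1.eventually_lt_const hav).and
    ((h2.eventually_const_lt hbv).and ((hc.eventually (hU.mem_nhds hpU)).and
    ((hc.eventually (hV.mem_nhds hpV)).and self_mem_nhdsWithin)))).exists
  have ht0 : (0 : ℝ) < t := ht
  simp only [slope_def_field, zero_smul, add_zero, sub_zero, hρ0, hσ0] at ht1 ht2
  have hneg : ρ (p + t • v) < 0 := by
    by_contra hcon
    exact absurd (div_nonneg (not_lt.1 hcon) ht0.le) (not_le.2 ht1)
  have hpos : ¬ σ (p + t • v) < 0 := by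
    intro hcon
    exact absurd (div_neg_of_neg_of_pos hcon ht0) (not_lt.2 ht2.le)
  exact hpos ((hVD _ htV).1 ((hUD _ htU).2 hneg))

/-- The outward unit normal can be computed from any local defining function. -/
theorem outwardUnitNormal_eq {D : Set ℂ} {p : ℂ} {ρ : ℂ → ℝ}
    (h : IsLocalDefiningFunction D p ρ) :
    outwardUnitNormal D p = ‖gradient ρ p‖⁻¹ • gradient ρ p := by
  have hex : ∃ ρ : ℂ → ℝ, IsLocalDefiningFunction D p ρ := ⟨ρ, h⟩
  rw [outwardUnitNormal, dif_pos hex]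
  exact hex.choose_spec.normalized_gradient_eq h

/-! Two facts combine: Green's formula `2i ∫_D ∂f/∂z* = ∫_{∂D} f dz` on a domain with smooth
boundary, and the formula `∫ (∂v/∂z*) / (z - λ) = -π v(λ)` over the whole plane for compactly
supported `v`. A bump function `χ`, equal to 1 near `λ` and supported in `D`, splits `u` as `χu + (1
- χ)u`. The plane formula handles `χu`. The quotient `(1 - χ)u / (z - λ)` vanishes near `λ`, hence
has no singularity; Green's formula applies to it, and on the boundary it agrees with `u / (z - λ)`.
No small disc around `λ` has to be removed.

Green's formula is proved locally and glued by a partition of unity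
(`HasSmoothBoundary.hasGreenFormula`). Near a boundary point the implicit function theorem turns `D`
into a subgraph in a rotated frame (`IsLocalDefiningFunction.exists_graphHomeomorph`). A shear of
Jacobian one flattens it to a half-plane, where the formula is the fundamental theorem of calculus
on vertical half-lines. Since the boundary integral is taken against Hausdorff measure, it must be
matched with an integral over the parameter of the graph; this is `comap_hausdorffMeasure_one`.

The plane formula is a computation in polar coordinates: the Jacobian cancels the singularity, the
radial derivative integrates to `-v(λ)` on each ray, and the angular derivative integrates to zero
by periodicity. -/

/-! ### Hausdorff measure on a curve and arc length -/

/-- Near a point of strict differentiability, a curve distorts distances by a factor close to its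
speed. -/
theorem HasStrictDerivAt.exists_dist_bounds {E : Type*} [NormedAddCommGroup E] [NormedSpace ℝ E]
    {γ : ℝ → E} {v : E} {x : ℝ} (h : HasStrictDerivAt γ v x) {ε : ℝ} (hε : 0 < ε) :
    ∃ s ∈ 𝓝 x, ∀ a ∈ s, ∀ b ∈ s, dist (γ a) (γ b) ≤ (‖v‖ + ε) * dist a b ∧
      (‖v‖ - ε) * dist a b ≤ dist (γ a) (γ b) := by
  have h1 := h.isLittleO.def hε
  rw [nhds_prod_eq] at h1
  obtain ⟨s, hs, H⟩ := mem_prod_same_iff.1 h1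
  refine ⟨s, hs, fun a ha b hb => ?_⟩
  have h2 : ‖γ a - γ b - _‖ ≤ ε * ‖a - b‖ := H (mk_mem_prod ha hb)
  simp only [ContinuousLinearMap.toSpanSingleton_apply] at h2
  rw [dist_eq_norm, dist_eq_norm]
  have h3 : ‖(a - b) • v‖ = ‖v‖ * ‖a - b‖ := by rw [norm_smul, mul_comm]
  have h4 := norm_sub_norm_le (γ a - γ b) ((a - b) • v)
  have h5 := norm_sub_norm_le ((a - b) • v) (γ a - γ b)
  rw [norm_sub_rev ((a - b) • v)] at h5
  constructor <;> nlinarith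

section CurveMeasure

variable {E : Type*} [NormedAddCommGroup E] [NormedSpace ℝ E] [MeasurableSpace E] [BorelSpace E]

/-- A `K`-Lipschitz map multiplies one-dimensional Hausdorff measure by at most `K`. The upper bound
applies this to `γ`, the lower bound to its inverse on the image. -/
theorem HasStrictDerivAt.exists_hausdorffMeasure_image_bounds {γ : ℝ → E} {v : E} {x : ℝ}
    (h : HasStrictDerivAt γ v x) (hinj : Function.Injective γ) {ε : ℝ} (hε : 0 < ε) :
    ∃ s ∈ 𝓝 x, ∀ A ⊆ s, Measure.hausdorffMeasure 1 (γ '' A) ≤ ENNReal.ofReal (‖v‖ + ε) * volume A ∧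
      ENNReal.ofReal (‖v‖ - ε) * volume A ≤ Measure.hausdorffMeasure 1 (γ '' A) := by
  obtain ⟨s, hs, H⟩ := h.exists_dist_bounds hε
  refine ⟨s, hs, fun A hA => ⟨?_, ?_⟩⟩
  · have hL : LipschitzOnWith (Real.toNNReal (‖v‖ + ε)) γ A := by
      refine LipschitzOnWith.of_dist_le_mul fun a ha b hb => ?_
      rw [Real.coe_toNNReal _ (by positivity)]
      exact (H a (hA ha) b (hA hb)).1
    have := hL.hausdorffMeasure_image_le (d := 1) zero_le_one
    simpa [hausdorffMeasure_real, ENNReal.ofReal] using this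
  -- If the speed is at most `ε`, the lower constant is truncated to zero and nothing is claimed.
  · rcases le_or_gt (‖v‖) ε with hle | hlt
    · rw [ENNReal.ofReal_of_nonpos (by linarith)]; simp
    have hpos : 0 < ‖v‖ - ε := by linarith
    have hL : LipschitzOnWith (Real.toNNReal (‖v‖ - ε)⁻¹) (Function.invFun γ) (γ '' A) := by
      refine LipschitzOnWith.of_dist_le_mul ?_
      rintro _ ⟨a, ha, rfl⟩ _ ⟨b, hb, rfl⟩
      rw [Real.coe_toNNReal _ (by positivity), Function.leftInverse_invFun hinj a,
        Function.leftInverse_invFun hinj b, inv_mul_eq_div, le_div_iff₀ hpos, mul_comm]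
      exact (H a (hA ha) b (hA hb)).2
    have := hL.hausdorffMeasure_image_le (d := 1) zero_le_one
    rw [← image_comp, (Function.leftInverse_invFun hinj).comp_eq_id, image_id,
      hausdorffMeasure_real] at this
    have h6 : ((Real.toNNReal (‖v‖ - ε)⁻¹ : NNReal) : ENNReal) ^ (1 : ℝ)
        = (ENNReal.ofReal (‖v‖ - ε))⁻¹ := by
      rw [ENNReal.rpow_one, ← ENNReal.ofReal_inv_of_pos hpos]; rfl
    rw [h6] at this
    rw [mul_comm]
    refine (mul_le_mul_left this _).trans (le_of_eq ?_)
    rw [mul_comm, ← mul_assoc, ENNReal.mul_inv_cancel, one_mul]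
    · simpa using hpos
    · simp

/-- Arc length: the pullback of one-dimensional Hausdorff measure along an injective `C¹`
curve is Lebesgue measure with the speed as density. -/
theorem comap_hausdorffMeasure_one {γ : ℝ → E} (hγ : ContDiff ℝ 1 γ)
    (hemb : MeasurableEmbedding γ) :
    (Measure.hausdorffMeasure 1 : Measure E).comap γ
      = volume.withDensity (fun x => ‖deriv γ x‖ₑ) := by
  set ν := (Measure.hausdorffMeasure 1 : Measure E).comap γ with hν
  have hνA : ∀ A, ν A = Measure.hausdorffMeasure 1 (γ '' A) := fun A => hemb.comap_apply _ _
  have hd : ∀ x, HasStrictDerivAt γ (deriv γ x) x := fun x =>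
    (hγ.contDiffAt (x := x)).hasStrictDerivAt one_ne_zero
  have B := fun x {ε : ℝ} (hε : 0 < ε) =>
    (hd x).exists_hausdorffMeasure_image_bounds hemb.injective hε
  simp only [← hνA] at B
  have hfin : IsLocallyFiniteMeasure ν := ⟨fun x => by
    obtain ⟨s, hs, H⟩ := B x one_pos
    refine ⟨s ∩ Metric.ball x 1, inter_mem hs (Metric.ball_mem_nhds x one_pos), ?_⟩
    refine (H _ inter_subset_left).1.trans_lt (ENNReal.mul_lt_top (by simp) ?_)
    exact (measure_mono inter_subset_right).trans_lt measure_ball_lt_top⟩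
  have hac : ν ≪ volume := by
    intro A hA
    refine measure_null_of_locally_null A fun x _ => ?_
    obtain ⟨s, hs, H⟩ := B x one_pos
    refine ⟨A ∩ s, inter_mem_nhdsWithin A hs, ?_⟩
    have := (H (A ∩ s) inter_subset_right).1
    rw [measure_mono_null inter_subset_left hA, mul_zero] at this
    exact le_antisymm this bot_le
  rw [← Measure.withDensity_rnDeriv_eq ν volume hac]
  refine withDensity_congr_ae ?_
  -- The density is almost everywhere the limit of the ratios of the two measures on shrinking
  -- balls, and the local bounds keep these ratios within `ε` of the speed.
  filter_upwards [Besicovitch.ae_tendsto_rnDeriv ν volume] with x hx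
  refine tendsto_nhds_unique hx ?_
  rw [ENNReal.tendsto_nhds (by simp)]
  intro ε hε
  rcases eq_or_ne ε ⊤ with rfl | hεt
  · exact Eventually.of_forall fun r => by simp
  have hε' : 0 < ε.toReal := ENNReal.toReal_pos hε.ne' hεt
  obtain ⟨s, hs, H⟩ := B x hε'
  obtain ⟨δ, hδ, hδs⟩ := Metric.nhds_basis_closedBall.mem_iff.1 hs
  filter_upwards [Ioc_mem_nhdsGT hδ] with r hr
  have hsub := (Metric.closedBall_subset_closedBall hr.2).trans hδs
  have hv0 : volume (Metric.closedBall x r) ≠ 0 :=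
    (Metric.measure_closedBall_pos _ _ hr.1).ne'
  have hvt : volume (Metric.closedBall x r) ≠ ⊤ := measure_closedBall_lt_top.ne
  obtain ⟨h1, h2⟩ := H _ hsub
  rw [ENNReal.ofReal_add (norm_nonneg _) hε'.le, ENNReal.ofReal_toReal hεt, ofReal_norm] at h1
  rw [ENNReal.ofReal_sub _ hε'.le, ENNReal.ofReal_toReal hεt, ofReal_norm] at h2
  exact ⟨(ENNReal.le_div_iff_mul_le (.inl hv0) (.inl hvt)).2 h2,
    (ENNReal.div_le_iff hv0 hvt).2 h1⟩

theorem integrableOn_range_hausdorffMeasure_iff {γ : ℝ → E} (hγ : ContDiff ℝ 1 γ)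
    (hemb : MeasurableEmbedding γ) {f : E → ℂ} :
    IntegrableOn f (range γ) (Measure.hausdorffMeasure 1)
      ↔ Integrable (fun x => ‖deriv γ x‖ • f (γ x)) := by
  have hm : Measurable fun x => ‖deriv γ x‖₊ :=
    (hγ.continuous_deriv le_rfl).nnnorm.measurable
  rw [IntegrableOn, ← hemb.map_comap, comap_hausdorffMeasure_one hγ hemb,
    hemb.integrable_map_iff]
  exact integrable_withDensity_iff_integrable_smul (E := ℂ) hm

theorem setIntegral_range_hausdorffMeasure {γ : ℝ → E} (hγ : ContDiff ℝ 1 γ)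
    (hemb : MeasurableEmbedding γ) (f : E → ℂ) :
    ∫ z in range γ, f z ∂(Measure.hausdorffMeasure 1 : Measure E)
      = ∫ x, ‖deriv γ x‖ • f (γ x) := by
  have hm : Measurable fun x => ‖deriv γ x‖₊ :=
    (hγ.continuous_deriv le_rfl).nnnorm.measurable
  rw [← hemb.map_comap, comap_hausdorffMeasure_one hγ hemb, hemb.integral_map]
  exact integral_withDensity_eq_integral_smul (E := ℂ) hm _

end CurveMeasure

/-! ### Integration by parts on a half-plane -/

theorem HasCompactSupport.comp_prodMk_left {X Y : Type*} [TopologicalSpace X] [TopologicalSpace Y]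
    [T1Space Y] {F : X × Y → ℂ} (hF : HasCompactSupport F) (y : Y) :
    HasCompactSupport (fun x => F (x, y)) :=
  hF.comp_isClosedEmbedding
    ⟨⟨isInducing_prodMkLeft y, Prod.mk_left_injective y⟩, by
      have : range (fun x : X => (x, y)) = Prod.snd ⁻¹' {y} := by
        ext ⟨a, b⟩; simp [eq_comm]
      rw [this]; exact isClosed_singleton.preimage continuous_snd⟩

theorem HasCompactSupport.comp_prodMk_right {X Y : Type*} [TopologicalSpace X] [TopologicalSpace Y]
    [T1Space X] {F : X × Y → ℂ} (hF : HasCompactSupport F) (x : X) :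
    HasCompactSupport (fun y => F (x, y)) :=
  hF.comp_isClosedEmbedding
    ⟨⟨isInducing_prodMkRight x, Prod.mk_right_injective x⟩, by
      have : range (fun y : Y => (x, y)) = Prod.fst ⁻¹' {x} := by
        ext ⟨a, b⟩; simp [eq_comm]
      rw [this]; exact isClosed_singleton.preimage continuous_fst⟩

section HalfPlane

variable {F : ℝ × ℝ → ℂ}

theorem volume_restrict_univ_prod (s : Set ℝ) :
    (volume : Measure (ℝ × ℝ)).restrict (univ ×ˢ s) = volume.prod (volume.restrict s) := by
  rw [Measure.volume_eq_prod, ← Measure.prod_restrict, Measure.restrict_univ]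

theorem integrable_mul_fderiv_apply (hF : ContDiff ℝ 1 F) (hFc : HasCompactSupport F) {k : ℝ → ℂ}
    (hk : Continuous k) (v : ℝ × ℝ) : Integrable (fun q : ℝ × ℝ => k q.1 * fderiv ℝ F q v) := by
  have h1 : Continuous (fun q => fderiv ℝ F q v) :=
    (hF.continuous_fderiv one_ne_zero).clm_apply continuous_const
  refine Continuous.integrable_of_hasCompactSupport (by fun_prop) ?_
  exact (hFc.fderiv_apply (𝕜 := ℝ) v).mul_left

/-- On each horizontal line the integrand is the derivative of a compactly supported function. -/
theorem setIntegral_halfPlane_fderiv_fst (hF : ContDiff ℝ 1 F) (hFc : HasCompactSupport F) :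
    ∫ q in univ ×ˢ Iio (0 : ℝ), fderiv ℝ F q (1, 0) = 0 := by
  have hi : Integrable (fun q : ℝ × ℝ => fderiv ℝ F q (1, 0)) := by
    simpa using integrable_mul_fderiv_apply hF hFc (k := fun _ => 1) continuous_const (1, 0)
  rw [volume_restrict_univ_prod, integral_prod_symm]
  · have : ∀ y : ℝ, ∫ x, fderiv ℝ F (x, y) (1, 0) = 0 := by
      intro y
      have hd : ∀ x : ℝ, HasDerivAt (fun x => F (x, y)) (fderiv ℝ F (x, y) (1, 0)) x := fun x =>
        ((hF.differentiable one_ne_zero) (x, y)).hasFDerivAt.comp_hasDerivAt x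
          ((hasDerivAt_id x).prodMk (hasDerivAt_const x y))
      refine integral_eq_zero_of_hasDerivAt_of_integrable hd ?_ ?_
      · refine Continuous.integrable_of_hasCompactSupport ?_
          ((hFc.fderiv_apply (𝕜 := ℝ) (1, 0)).comp_prodMk_left y)
        exact ((hF.continuous_fderiv one_ne_zero).comp (by fun_prop)).clm_apply continuous_const
      · exact Continuous.integrable_of_hasCompactSupport (hF.continuous.comp (by fun_prop))
          (hFc.comp_prodMk_left y)
    simp [this]
  · rw [← volume_restrict_univ_prod]; exact hi.integrableOn

/-- The weight depends only on the horizontal variable, so it leaves the inner integral, and the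
fundamental theorem of calculus on the vertical half-line leaves the boundary value. The weight will
carry the slope of the graph. -/
theorem setIntegral_halfPlane_mul_fderiv_snd (hF : ContDiff ℝ 1 F) (hFc : HasCompactSupport F)
    {k : ℝ → ℂ} (hk : Continuous k) :
    ∫ q in univ ×ˢ Iio (0 : ℝ), k q.1 * fderiv ℝ F q (0, 1) = ∫ x, k x * F (x, 0) := by
  rw [volume_restrict_univ_prod, integral_prod]
  · refine integral_congr_ae (.of_forall fun x => ?_)
    have hd : ∀ y : ℝ, HasDerivAt (fun y => F (x, y)) (fderiv ℝ F (x, y) (0, 1)) y := fun y =>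
      ((hF.differentiable one_ne_zero) (x, y)).hasFDerivAt.comp_hasDerivAt y
        ((hasDerivAt_const y x).prodMk (hasDerivAt_id y))
    have h1 := HasCompactSupport.integral_Iic_deriv_eq (f := fun y => F (x, y))
      (hF.comp (by fun_prop)) (hFc.comp_prodMk_right x) 0
    simp only [fun y => (hd y).deriv] at h1
    simp only [integral_const_mul, ← h1, integral_Iic_eq_integral_Iio]
  · rw [← volume_restrict_univ_prod]
    exact (integrable_mul_fderiv_apply hF hFc hk _).integrableOn

end HalfPlane

/-! ### Green's formula below a graph -/

/-- The coordinates `(x, t) ↦ p + c (x + i (g x + t))`, straightening the graph of `g` in the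
frame at `p` rotated by `c`. -/
noncomputable def graphHomeomorph {g : ℝ → ℝ} (hg : Continuous g) (p : ℂ) (c : Circle) :
    ℝ × ℝ ≃ₜ ℂ where
  toFun q := p + c * (q.1 + Complex.I * ((g q.1 + q.2 : ℝ) : ℂ))
  invFun z := (((c⁻¹ : Circle) * (z - p)).re,
    ((c⁻¹ : Circle) * (z - p)).im - g (((c⁻¹ : Circle) * (z - p)).re))
  left_inv q := by
    simp only [add_sub_cancel_left, ← mul_assoc, ← Circle.coe_mul, inv_mul_cancel, Circle.coe_one]
    ext <;> simp
  right_inv z := by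
    have : ((((c⁻¹ : Circle) * (z - p)).re : ℂ) + Complex.I * (((c⁻¹ : Circle) * (z - p)).im : ℂ))
      = (c⁻¹ : Circle) * (z - p) := by rw [mul_comm Complex.I, Complex.re_add_im]
    simp only [add_sub_cancel]
    rw [this, ← mul_assoc, ← Circle.coe_mul]; simp
  continuous_toFun := by fun_prop
  continuous_invFun := by
    have : Continuous (fun z : ℂ => ((c⁻¹ : Circle) * (z - p) : ℂ)) := by fun_prop
    exact (Complex.continuous_re.comp this).prodMk ((Complex.continuous_im.comp this).sub
      (hg.comp (Complex.continuous_re.comp this)))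

section Graph

variable {g : ℝ → ℝ} (p : ℂ) (c : Circle)

theorem graphHomeomorph_apply (hg : Continuous g) (q : ℝ × ℝ) :
    graphHomeomorph hg p c q = p + c * (q.1 + Complex.I * ((g q.1 + q.2 : ℝ) : ℂ)) := rfl

/-- A shear followed by a rotation and a translation. Translation invariance on each vertical line
gives the shear, so `g` need not be differentiable. -/
theorem measurePreserving_graphHomeomorph (hg : Continuous g) :
    MeasurePreserving (graphHomeomorph hg p c) volume volume := by
  have h1 : MeasurePreserving (fun q : ℝ × ℝ => (q.1, g q.1 + q.2))
      (volume.prod volume) (volume.prod volume) :=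
    (MeasurePreserving.id volume).skew_product (g := fun x t => g x + t)
      (by unfold Function.uncurry; fun_prop)
      (.of_forall fun x => (measurePreserving_add_left volume (g x)).map_eq)
  have h2 := Complex.volume_preserving_equiv_real_prod.symm.comp h1
  have h3 := (rotation c).measurePreserving.comp h2
  have h4 := (measurePreserving_add_left volume p).comp h3
  have h5 : ⇑(graphHomeomorph hg p c) = (fun x => p + x) ∘ ⇑(rotation c) ∘
      ⇑Complex.measurableEquivRealProd.symm ∘ fun q => (q.1, g q.1 + q.2) := by
    funext q
    simp only [graphHomeomorph_apply, Function.comp_apply, rotation_apply]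
    congr 2
    apply Complex.ext <;> simp [Complex.measurableEquivRealProd]
  rw [h5]
  exact h4

/-- Rotating the frame by `c` multiplies `∂_x + i ∂_y` by the conjugate of `c`, which the factor `c`
undoes. It serves both the rotated graph frame and, with `c = e^{iθ}`, polar coordinates. -/
theorem two_mul_dzStarDeriv_eq (f : ℂ → ℂ) (z : ℂ) :
    2 * dzStarDeriv f z
      = c * (fderiv ℝ f z c + Complex.I * fderiv ℝ f z (c * Complex.I)) := by
  have h1 : (c : ℂ) = (c : ℂ).re • (1 : ℂ) + (c : ℂ).im • Complex.I := by
    apply Complex.ext <;> simp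
  have h2 : (c : ℂ) * Complex.I = (-(c : ℂ).im) • (1 : ℂ) + (c : ℂ).re • Complex.I := by
    apply Complex.ext <;> simp
  have h3 : (c : ℂ) * ((c : ℂ).re - Complex.I * (c : ℂ).im) = 1 := by
    have : ((c : ℂ).re - Complex.I * (c : ℂ).im : ℂ) = (starRingEnd ℂ) c := by
      apply Complex.ext <;> simp
    rw [this, Complex.mul_conj, Circle.normSq_coe]; simp
  have h4 : fderiv ℝ f z c = (c : ℂ).re * fderiv ℝ f z 1 + (c : ℂ).im * fderiv ℝ f z Complex.I := by
    conv_lhs => rw [h1]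
    rw [map_add, map_smul, map_smul, Complex.real_smul, Complex.real_smul]
  have h5 : fderiv ℝ f z (c * Complex.I)
      = -(c : ℂ).im * fderiv ℝ f z 1 + (c : ℂ).re * fderiv ℝ f z Complex.I := by
    rw [h2, map_add, map_smul, map_smul, Complex.real_smul, Complex.real_smul]
    push_cast; ring
  rw [h4, h5, dzStarDeriv]
  linear_combination (-(fderiv ℝ f z 1 + Complex.I * fderiv ℝ f z Complex.I)) * h3 -
    (c : ℂ) * (c : ℂ).im * fderiv ℝ f z Complex.I * Complex.I_sq

theorem contDiff_graphHomeomorph (hg : ContDiff ℝ 1 g) :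
    ContDiff ℝ 1 (graphHomeomorph hg.continuous p c) := by
  have h : ContDiff ℝ 1 (fun q : ℝ × ℝ => ((q.1 : ℂ) + Complex.I * ((g q.1 + q.2 : ℝ) : ℂ))) :=
    (Complex.ofRealCLM.contDiff.comp contDiff_fst).add (contDiff_const.mul
      (Complex.ofRealCLM.contDiff.comp ((hg.comp contDiff_fst).add contDiff_snd)))
  exact contDiff_const.add (contDiff_const.mul h)

theorem hasDerivAt_graph (hg : ContDiff ℝ 1 g) (x : ℝ) (t : ℝ) :
    HasDerivAt (fun x => graphHomeomorph hg.continuous p c (x, t))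
      (c * (1 + Complex.I * (deriv g x : ℝ))) x := by
  have h1 : HasDerivAt g (deriv g x) x := (hg.differentiable one_ne_zero x).hasDerivAt
  simp only [graphHomeomorph_apply]
  exact (((hasDerivAt_id x).ofReal_comp.add
    ((h1.add_const t).ofReal_comp.const_mul Complex.I)).const_mul (c : ℂ)).const_add p

theorem hasDerivAt_graph_snd (hg : ContDiff ℝ 1 g) (x : ℝ) (t : ℝ) :
    HasDerivAt (fun t => graphHomeomorph hg.continuous p c (x, t)) (c * Complex.I) t := by
  simp only [graphHomeomorph_apply]
  simpa using ((((hasDerivAt_id t).const_add (g x)).ofReal_comp.const_mul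
    Complex.I).const_add (x : ℂ)).const_mul (c : ℂ) |>.const_add p

/-- Green's formula for a compactly supported function on the subgraph of a `C¹` function. -/
theorem setIntegral_subgraph_dzStarDeriv (hg : ContDiff ℝ 1 g) {f : ℂ → ℂ} (hf : ContDiff ℝ 1 f)
    (hfc : HasCompactSupport f) :
    ∫ z in graphHomeomorph hg.continuous p c '' (univ ×ˢ Iio 0), 2 * dzStarDeriv f z
      = ∫ x, c * (Complex.I - (deriv g x : ℝ)) * f (graphHomeomorph hg.continuous p c (x, 0)) := by
  set Φ := graphHomeomorph hg.continuous p c with hΦ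
  have hΦd := contDiff_graphHomeomorph p c hg
  rw [← hΦ] at hΦd
  set F : ℝ × ℝ → ℂ := fun q => f (Φ q) with hFdef
  have hF : ContDiff ℝ 1 F := hf.comp hΦd
  have hFc : HasCompactSupport F := hfc.comp_isClosedEmbedding Φ.isClosedEmbedding
  have h1 : ∀ q : ℝ × ℝ, fderiv ℝ F q (1, 0)
      = fderiv ℝ f (Φ q) (c * (1 + Complex.I * (deriv g q.1 : ℝ))) := fun q => by
    have e1 := (hF.differentiable one_ne_zero q).hasFDerivAt.comp_hasDerivAt (f := fun x => (x, q.2)) q.1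
      ((hasDerivAt_id q.1).prodMk (hasDerivAt_const q.1 q.2))
    have e2 := (hf.differentiable one_ne_zero (Φ q)).hasFDerivAt.comp_hasDerivAt
      (f := fun x => Φ (x, q.2)) q.1 (hasDerivAt_graph p c hg q.1 q.2)
    exact e1.unique e2
  have h2 : ∀ q : ℝ × ℝ, fderiv ℝ F q (0, 1) = fderiv ℝ f (Φ q) (c * Complex.I) := fun q => by
    have e1 := (hF.differentiable one_ne_zero q).hasFDerivAt.comp_hasDerivAt (f := fun t => (q.1, t)) q.2
      ((hasDerivAt_const q.2 q.1).prodMk (hasDerivAt_id q.2))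
    have e2 := (hf.differentiable one_ne_zero (Φ q)).hasFDerivAt.comp_hasDerivAt
      (f := fun t => Φ (q.1, t)) q.2 (hasDerivAt_graph_snd p c hg q.1 q.2)
    exact e1.unique e2
  -- In sheared coordinates the horizontal derivative of `F` contains `g'` times the vertical one;
  -- subtracting it gives the coefficient `i - g'`.
  have h3 : ∀ q : ℝ × ℝ, 2 * dzStarDeriv f (Φ q) = c * fderiv ℝ F q (1, 0)
      + c * (Complex.I - (deriv g q.1 : ℝ)) * fderiv ℝ F q (0, 1) := fun q => by
    have : (c : ℂ) * (1 + Complex.I * (deriv g q.1 : ℝ))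
      = c + (deriv g q.1) • (c * Complex.I) := by rw [Complex.real_smul]; ring
    rw [two_mul_dzStarDeriv_eq c, h1, h2, this, map_add, map_smul, Complex.real_smul]
    ring
  have hk : Continuous (fun x => c * (Complex.I - (deriv g x : ℝ)) : ℝ → ℂ) := by
    have := hg.continuous_deriv le_rfl
    fun_prop
  rw [← setIntegral_halfPlane_mul_fderiv_snd hF hFc hk,
    (measurePreserving_graphHomeomorph p c hg.continuous).setIntegral_image_emb
      Φ.measurableEmbedding]
  simp only [← hΦ, h3]
  rw [integral_add, integral_const_mul, setIntegral_halfPlane_fderiv_fst hF hFc]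
  · simp
  · exact (integrable_mul_fderiv_apply hF hFc (k := fun _ => c) continuous_const _).integrableOn
  · exact (integrable_mul_fderiv_apply hF hFc hk _).integrableOn

end Graph

/-! ### The boundary as a graph -/

/-- The implicit function is `C¹` only near its base point; a cutoff makes it global, as the global
graph coordinates require. -/
theorem exists_contDiff_eventuallyEq {φ : ℝ → ℝ} {a : ℝ} (hφ : ContDiffAt ℝ 1 φ a) :
    ∃ g : ℝ → ℝ, ContDiff ℝ 1 g ∧ ∀ᶠ x in 𝓝 a, g x = φ x := by
  have h := hφ.eventually (by simp)
  obtain ⟨r, hr, hrs⟩ := Metric.nhds_basis_closedBall.mem_iff.1 h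
  let χ : ContDiffBump a := ⟨r / 2, r, by positivity, by linarith⟩
  refine ⟨fun x => χ x * φ x, contDiff_iff_contDiffAt.2 fun x => ?_, ?_⟩
  · by_cases hx : x ∈ Metric.closedBall a r
    · exact χ.contDiff.contDiffAt.mul (hrs hx)
    · have : (fun x => χ x * φ x) =ᶠ[𝓝 x] fun _ => 0 := by
        filter_upwards [Metric.isClosed_closedBall.isOpen_compl.mem_nhds hx] with y hy
        have : r < dist y a := by simpa using hy
        rw [χ.zero_of_le_dist this.le, zero_mul]
      exact contDiffAt_const.congr_of_eventuallyEq this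
  · filter_upwards [Metric.closedBall_mem_nhds a χ.rIn_pos] with x hx
    rw [χ.one_of_mem_closedBall hx, one_mul]

/-- A `C¹` real function of two variables, increasing in the second one, is locally negative exactly
below the graph of a `C¹` function. -/
theorem exists_graph_of_contDiffAt {R : ℝ × ℝ → ℝ} {a : ℝ × ℝ} (hR : ContDiffAt ℝ 1 R a)
    (ha : R a = 0) (hpos : 0 < fderiv ℝ R a (0, 1)) :
    ∃ g : ℝ → ℝ, ContDiff ℝ 1 g ∧ g a.1 = a.2 ∧ ∀ᶠ q in 𝓝 a, (R q < 0 ↔ q.2 < g q.1) ∧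
      R (q.1, g q.1) = 0 ∧ 0 < fderiv ℝ R q (0, 1) := by
  have hinv : (fderiv ℝ R a ∘L .inr ℝ ℝ ℝ).IsInvertible := by
    refine ⟨ContinuousLinearEquiv.unitsEquivAut ℝ (Units.mk0 _ hpos.ne'), ?_⟩
    ext; simp
  set φ := hR.implicitFunction one_ne_zero hinv with hφ
  obtain ⟨g, hg, hgφ⟩ := exists_contDiff_eventuallyEq
    (hR.contDiffAt_implicitFunction one_ne_zero hinv)
  have hga : g a.1 = a.2 := by
    rw [hgφ.self_of_nhds]; exact hR.implicitFunction_apply_self one_ne_zero hinv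
  have hz : ∀ᶠ x in 𝓝 a.1, R (x, g x) = 0 := by
    filter_upwards [hgφ, hR.eventually_apply_implicitFunction one_ne_zero hinv] with x h1 h2
    rw [h1, h2, ha]
  have hfc : ∀ᶠ q in 𝓝 a, DifferentiableAt ℝ R q ∧ 0 < fderiv ℝ R q (0, 1) := by
    have h1 : ContinuousAt (fun q => fderiv ℝ R q (0, 1)) a :=
      (hR.fderiv_right (m := 0) (by simp)).continuousAt.clm_apply continuousAt_const
    filter_upwards [hR.eventually (by simp), h1.eventually (lt_mem_nhds hpos)] with q h2 h3
    exact ⟨h2.differentiableAt one_ne_zero, h3⟩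
  obtain ⟨r, hr, hrs⟩ := Metric.nhds_basis_ball.mem_iff.1 hfc
  have hgr : ∀ᶠ x in 𝓝 a.1, g x ∈ Metric.ball a.2 r := by
    have := hg.continuous.continuousAt (x := a.1)
    rw [ContinuousAt, hga] at this
    exact this.eventually (Metric.ball_mem_nhds _ hr)
  refine ⟨g, hg, hga, ?_⟩
  have hfst : Tendsto Prod.fst (𝓝 a) (𝓝 a.1) := continuous_fst.continuousAt
  filter_upwards [hfst.eventually hz, hfst.eventually hgr, Metric.ball_mem_nhds a hr]
    with q h1 h2 h3
  refine ⟨?_, h1, (hrs h3).2⟩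
  -- In the sup metric the ball is a product of intervals. It therefore contains the vertical
  -- segment from `q` to the graph, and monotonicity of `R` along this segment decides its sign.
  rw [← Prod.mk.eta (p := a), ← ball_prod_same] at h3 hrs
  have hd : ∀ y ∈ Metric.ball a.2 r, HasDerivAt (fun y => R (q.1, y))
      (fderiv ℝ R (q.1, y) (0, 1)) y := fun y hy =>
    (hrs (mk_mem_prod h3.1 hy)).1.hasFDerivAt.comp_hasDerivAt y
      ((hasDerivAt_const y q.1).prodMk (hasDerivAt_id y))
  have hmono : StrictMonoOn (fun y => R (q.1, y)) (Metric.ball a.2 r) := by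
    refine strictMonoOn_of_deriv_pos (convex_ball _ _)
      (fun y hy => (hd y hy).continuousAt.continuousWithinAt) fun y hy => ?_
    rw [Metric.isOpen_ball.interior_eq] at hy
    rw [(hd y hy).deriv]
    exact (hrs (mk_mem_prod h3.1 hy)).2
  have := hmono.lt_iff_lt h3.2 h2
  simpa [h1] using this

/-- Near a boundary point with a local defining function, `D` is the region below the graph of a
`C¹` function in a rotated frame, and its tangent is the reversed normalized velocity of the
graph. -/
theorem IsLocalDefiningFunction.exists_graphHomeomorph {D : Set ℂ} {p : ℂ} {ρ : ℂ → ℝ}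
    (h : IsLocalDefiningFunction D p ρ) :
    ∃ (c : Circle) (g : ℝ → ℝ) (hg : ContDiff ℝ 1 g) (V : Set ℂ), IsOpen V ∧ p ∈ V ∧
      (∀ q : ℝ × ℝ, graphHomeomorph hg.continuous p c q ∈ V →
        (graphHomeomorph hg.continuous p c q ∈ D ↔ q.2 < 0)) ∧
      ∀ x : ℝ, graphHomeomorph hg.continuous p c (x, 0) ∈ V →
        ‖(c * (1 + Complex.I * (deriv g x : ℝ)) : ℂ)‖ •
          positiveUnitTangent D (graphHomeomorph hg.continuous p c (x, 0))
        = -(c * (1 + Complex.I * (deriv g x : ℝ))) := by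
  have hgrad := h.gradient_ne_zero
  obtain ⟨U, hU, hpU, hρ, hp0, -, hDU⟩ := id h
  set n : ℂ := gradient ρ p with hn
  -- The frame is rotated so that its upward direction `c i` is the outward unit normal at `p`.
  have hcn : ‖-Complex.I * (‖n‖⁻¹ • n)‖ = 1 := by
    rw [norm_mul, norm_smul, norm_inv, norm_norm, inv_mul_cancel₀ (norm_ne_zero_iff.2 hgrad)]
    simp
  obtain ⟨c, hc⟩ : ∃ c : Circle, (c : ℂ) = -Complex.I * (‖n‖⁻¹ • n) :=
    ⟨⟨_, mem_sphere_zero_iff_norm.2 hcn⟩, rfl⟩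
  have hcI : (c : ℂ) * Complex.I = ‖n‖⁻¹ • n := by
    rw [hc]
    linear_combination -(‖n‖⁻¹ • n) * Complex.I_sq
  let e : ℝ × ℝ → ℂ := fun q => p + c * (q.1 + Complex.I * (q.2 : ℂ))
  have he : ContDiff ℝ 1 e := contDiff_const.add (contDiff_const.mul
    ((Complex.ofRealCLM.contDiff.comp contDiff_fst).add (contDiff_const.mul
      (Complex.ofRealCLM.contDiff.comp contDiff_snd))))
  have he0 : e (0, 0) = p := by simp [e]
  have hρd : ∀ z ∈ U, ContDiffAt ℝ 1 ρ z := fun z hz =>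
    (hρ.contDiffAt (hU.mem_nhds hz)).of_le (by simp)
  have hdir : ∀ q, e q ∈ U → fderiv ℝ (ρ ∘ e) q (0, 1) = fderiv ℝ ρ (e q) (c * Complex.I) := by
    intro q hq
    have hde : HasDerivAt (fun t => e (q.1, t)) (c * Complex.I) q.2 := by
      simpa [e] using ((((hasDerivAt_id q.2)).ofReal_comp.const_mul
        Complex.I).const_add (q.1 : ℂ)).const_mul (c : ℂ) |>.const_add p
    have e2 := ((hρd _ hq).differentiableAt one_ne_zero).hasFDerivAt.comp_hasDerivAt
      (f := fun t => e (q.1, t)) q.2 hde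
    have e1 := (((hρd _ hq).comp q he.contDiffAt).differentiableAt
      one_ne_zero).hasFDerivAt.comp_hasDerivAt (f := fun t => (q.1, t)) q.2
      ((hasDerivAt_const q.2 q.1).prodMk (hasDerivAt_id q.2))
    exact e1.unique e2
  have hin : ∀ z y, fderiv ℝ ρ z y = inner ℝ (gradient ρ z) y := fun z y => by simp [gradient]
  obtain ⟨g, hg, hg0, hgq⟩ := exists_graph_of_contDiffAt (R := ρ ∘ e) (a := (0, 0))
    ((hρd _ (by rwa [he0])).comp _ he.contDiffAt) (by simp [he0, hp0]) (by
      rw [hdir _ (by rwa [he0]), he0, hcI, map_smul]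
      have h1 : fderiv ℝ ρ p n = ‖n‖ ^ 2 := by
        rw [← real_inner_self_eq_norm_sq, ← hin]
      have : 0 < ‖n‖ := norm_pos_iff.2 hgrad
      rw [h1, smul_eq_mul]; positivity)
  replace hg0 : g 0 = 0 := hg0
  let Φ := graphHomeomorph hg.continuous p c
  have hΦe : ∀ q, Φ q = e (q.1, g q.1 + q.2) := fun q => rfl
  have hΦ0 : Φ (0, 0) = p := by rw [hΦe]; simp [hg0, he0]
  have hs : Tendsto (fun q : ℝ × ℝ => (q.1, g q.1 + q.2)) (𝓝 (0, 0)) (𝓝 (0, 0)) := by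
    have : Continuous (fun q : ℝ × ℝ => (q.1, g q.1 + q.2)) := by
      have := hg.continuous; fun_prop
    simpa [hg0] using this.tendsto (0, 0)
  have hev : ∀ᶠ z in 𝓝 p, z ∈ U ∧ (ρ z < 0 ↔ (Φ.symm z).2 < 0) ∧
      ρ (Φ ((Φ.symm z).1, 0)) = 0 ∧ 0 < fderiv ℝ ρ z (c * Complex.I) := by
    have h1 : Tendsto Φ.symm (𝓝 p) (𝓝 (0, 0)) := by
      have := Φ.symm.continuous.tendsto p
      rwa [← hΦ0, Φ.symm_apply_apply, hΦ0] at this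
    filter_upwards [hU.mem_nhds hpU, (hs.comp h1).eventually hgq] with z hzU hz
    obtain ⟨z1, z2, z3⟩ := hz
    have e1 : e ((Φ.symm z).1, g (Φ.symm z).1 + (Φ.symm z).2) = z := by
      rw [← hΦe, Φ.apply_symm_apply]
    simp only [Function.comp_apply, e1] at z1 z2
    rw [Function.comp_apply, hdir _ (by rwa [e1]), e1] at z3
    refine ⟨hzU, ?_, ?_, z3⟩
    · rw [z1, add_lt_iff_neg_left]
    · rw [hΦe]; simpa using z2
  obtain ⟨V, hVsub, hV, hpV⟩ := eventually_nhds_iff.1 hev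
  refine ⟨c, g, hg, V, hV, hpV, fun q hq => ?_, fun x hx => ?_⟩
  · obtain ⟨h1, h2, -⟩ := hVsub _ hq
    rw [hDU _ h1]
    simpa [Φ] using h2
  · set z := graphHomeomorph hg.continuous p c (x, 0) with hz
    obtain ⟨h1, -, h3, h4⟩ := hVsub _ hx
    have h3' : ρ z = 0 := by simpa [Φ, hz] using h3
    -- The same `ρ` defines `D` at every nearby point of the graph: its derivative in the direction
    -- `c i` stays positive, so the normal there can be computed from its gradient.
    have hw : IsLocalDefiningFunction D z ρ :=
      ⟨U, hU, h1, hρ, h3', fun h0 => by simp [h0] at h4, hDU⟩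
    have hγ := hasDerivAt_graph p c hg x 0
    set v : ℂ := c * (1 + Complex.I * (deriv g x : ℝ)) with hv
    have hperp : fderiv ℝ ρ z v = 0 := by
      have e1 := ((hρd _ h1).differentiableAt one_ne_zero).hasFDerivAt.comp_hasDerivAt
        (f := fun x => Φ (x, 0)) x hγ
      have e2 : (ρ ∘ fun x => Φ (x, 0)) =ᶠ[𝓝 x] fun _ => 0 := by
        have : Continuous fun x => Φ (x, 0) := Φ.continuous.comp (by fun_prop)
        filter_upwards [this.continuousAt.preimage_mem_nhds (hV.mem_nhds hx)] with y hy
        simpa using (hVsub _ hy).2.2.1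
      exact (e1.congr_of_eventuallyEq e2.symm).unique (hasDerivAt_const x (0 : ℝ))
    rw [hin] at hperp h4
    rw [positiveUnitTangent, outwardUnitNormal_eq hw]
    set w := gradient ρ z with hwdef
    obtain ⟨ζ, hζ⟩ : ∃ ζ : ℂ, w = c * ζ := ⟨(c : ℂ)⁻¹ * w, by
      rw [← mul_assoc, mul_inv_cancel₀ c.coe_ne_zero, one_mul]⟩
    have hrot : ∀ a b : ℂ, inner ℝ (c * a) (c * b) = inner ℝ a b := fun a b =>
      (rotation c).inner_map_map a b
    rw [hζ, hv, hrot] at hperp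
    rw [hζ, hrot] at h4
    simp only [Complex.inner, Complex.mul_re, Complex.add_re, Complex.one_re, Complex.I_re,
      Complex.ofReal_re, Complex.I_im, Complex.ofReal_im, Complex.add_im, Complex.one_im,
      Complex.mul_im, Complex.conj_re, Complex.conj_im] at hperp h4
    -- The gradient is orthogonal to the velocity `v` and has a positive component along `c i`, so
    -- it is a positive multiple of `i v`. The positive tangent is thus `i · i v / |v| = -v / |v|`.
    have h5 : ζ = (ζ.im : ℂ) * (Complex.I * (1 + Complex.I * (deriv g x : ℝ))) := by
      apply Complex.ext
      · simp; linarith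
      · simp
    have h6 : w = ζ.im • (Complex.I * v) := by
      rw [hζ, Complex.real_smul, hv]; linear_combination (c : ℂ) * h5
    have him : 0 < ζ.im := by linarith
    have hvne : ‖v‖ ≠ 0 := by
      intro h0
      rw [norm_eq_zero] at h0
      have := hw.gradient_ne_zero
      rw [← hwdef, h6, h0] at this; simp at this
    have h7 : ‖w‖ = ζ.im * ‖v‖ := by
      rw [h6, norm_smul, norm_mul, Complex.norm_I, one_mul, Real.norm_of_nonneg him.le]
    change ‖v‖ • (Complex.I * (‖w‖⁻¹ • w)) = -v
    rw [h7, h6]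
    simp only [Complex.real_smul]
    have hvne' : (‖v‖ : ℂ) ≠ 0 := by exact_mod_cast hvne
    have him' : (ζ.im : ℂ) ≠ 0 := by exact_mod_cast him.ne'
    push_cast
    field_simp
    linear_combination v * Complex.I_sq

/-! ### Local Green's formula -/

/-- Green's formula `2i ∫_D ∂f/∂z* = ∫_{∂D} f dz`, with absolutely convergent integrals. -/
def HasGreenFormula (D : Set ℂ) (f : ℂ → ℂ) : Prop :=
  IntegrableOn (fun z => f z * positiveUnitTangent D z) (frontier D)
      (Measure.hausdorffMeasure 1) ∧
    IntegrableOn (dzStarDeriv f) D ∧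
    2 * Complex.I * ∫ z in D, dzStarDeriv f z
      = ∫ z in frontier D, f z * positiveUnitTangent D z ∂(Measure.hausdorffMeasure 1 : Measure ℂ)

theorem Filter.EventuallyEq.dzStarDeriv_eq {f g : ℂ → ℂ} {z : ℂ} (h : f =ᶠ[𝓝 z] g) :
    dzStarDeriv f z = dzStarDeriv g z := by
  rw [dzStarDeriv, dzStarDeriv, h.fderiv_eq]

theorem dzStarDeriv_of_notMem_tsupport {f : ℂ → ℂ} {z : ℂ} (h : z ∉ tsupport f) :
    dzStarDeriv f z = 0 := by
  rw [(notMem_tsupport_iff_eventuallyEq.1 h).dzStarDeriv_eq]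
  have : (0 : ℂ → ℂ) = fun _ => 0 := rfl
  rw [this]; simp [dzStarDeriv]

theorem continuousOn_dzStarDeriv {f : ℂ → ℂ} {s : Set ℂ} (hs : IsOpen s)
    (hf : ContDiffOn ℝ 1 f s) : ContinuousOn (dzStarDeriv f) s := by
  have h := hf.continuousOn_fderiv_of_isOpen hs le_rfl
  exact ((h.clm_apply continuousOn_const).add
    (continuousOn_const.mul (h.clm_apply continuousOn_const))).div_const 2

theorem continuous_dzStarDeriv {f : ℂ → ℂ} (hf : ContDiff ℝ 1 f) : Continuous (dzStarDeriv f) :=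
  continuousOn_univ.1 (continuousOn_dzStarDeriv isOpen_univ hf.contDiffOn)

theorem hasCompactSupport_dzStarDeriv {f : ℂ → ℂ} (hf : HasCompactSupport f) :
    HasCompactSupport (dzStarDeriv f) :=
  HasCompactSupport.of_support_subset_isCompact hf fun _ hz => by
    by_contra hc
    exact hz (dzStarDeriv_of_notMem_tsupport hc)

theorem integrable_dzStarDeriv {f : ℂ → ℂ} (hf : ContDiff ℝ 1 f) (hfc : HasCompactSupport f) :
    Integrable (dzStarDeriv f) :=
  (continuous_dzStarDeriv hf).integrable_of_hasCompactSupport (hasCompactSupport_dzStarDeriv hfc)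

theorem mem_image_graphHomeomorph_iff {g : ℝ → ℝ} (hg : Continuous g) (p : ℂ) (c : Circle)
    (z : ℂ) : z ∈ graphHomeomorph hg p c '' (univ ×ˢ Iio 0)
      ↔ ((graphHomeomorph hg p c).symm z).2 < 0 := by
  rw [Homeomorph.image_eq_preimage_symm]; simp

theorem integral_dzStarDeriv_eq_zero {f : ℂ → ℂ} (hf : ContDiff ℝ 1 f)
    (hfc : HasCompactSupport f) : ∫ z, dzStarDeriv f z = 0 := by
  obtain ⟨R, hR⟩ := hfc.isBounded.subset_closedBall 0
  have hg : ContDiff ℝ 1 (fun _ : ℝ => (0 : ℝ)) := contDiff_const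
  -- The horizontal line at height `R + 1` lies above the support of `f`, so the half-plane below it
  -- sees all of `f` and the boundary term vanishes.
  have key := setIntegral_subgraph_dzStarDeriv (Complex.I * ((R + 1 : ℝ) : ℂ)) 1 hg hf hfc
  have h1 : ∀ x : ℝ, f (graphHomeomorph hg.continuous (Complex.I * ((R + 1 : ℝ) : ℂ)) 1 (x, 0))
      = 0 := fun x => by
    refine image_eq_zero_of_notMem_tsupport fun hc => ?_
    have h2 := mem_closedBall_zero_iff.1 (hR hc)
    have h3 := (Complex.abs_im_le_norm _).trans h2
    have h4 := (le_abs_self _).trans h3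
    simp [graphHomeomorph_apply] at h4
    linarith
  simp only [h1, mul_zero, integral_zero] at key
  rw [setIntegral_eq_integral_of_forall_compl_eq_zero, integral_const_mul] at key
  · simpa using key
  · intro z hz
    rw [mem_image_graphHomeomorph_iff, not_lt] at hz
    rw [dzStarDeriv_of_notMem_tsupport, mul_zero]
    intro hc
    have h2 := mem_closedBall_zero_iff.1 (hR hc)
    have h4 := (le_abs_self _).trans ((Complex.abs_im_le_norm _).trans h2)
    simp [graphHomeomorph, Homeomorph.symm] at hz
    linarith

/-- Away from the boundary both sides of the formula are zero. -/
theorem hasGreenFormula_of_tsupport_subset {D : Set ℂ} (hD : IsOpen D) {f : ℂ → ℂ}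
    (hf : ContDiff ℝ 1 f) (hfc : HasCompactSupport f) (hfD : tsupport f ⊆ D) :
    HasGreenFormula D f := by
  have h0 : ∀ z ∈ frontier D, f z * positiveUnitTangent D z = 0 := fun z hz => by
    rw [hD.frontier_eq] at hz
    rw [image_eq_zero_of_notMem_tsupport (f := f) fun hc => hz.2 (hfD hc), zero_mul]
  refine ⟨?_, (integrable_dzStarDeriv hf hfc).integrableOn, ?_⟩
  · exact (integrableOn_congr_fun h0 isClosed_frontier.measurableSet).2 integrableOn_zero
  · rw [setIntegral_eq_zero_of_forall_eq_zero h0,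
      setIntegral_eq_integral_of_forall_compl_eq_zero, integral_dzStarDeriv_eq_zero hf hfc, mul_zero]
    exact fun z hz => dzStarDeriv_of_notMem_tsupport fun hc => hz (hfD hc)

/-- In `V` the sets `D` and `frontier D` coincide with a subgraph and its graph, and off `V` the
function vanishes, so both integrals can be moved to the subgraph. The speed in the arc length
cancels the normalization of the tangent. -/
theorem IsLocalDefiningFunction.exists_hasGreenFormula {D : Set ℂ} (hD : IsOpen D) {p : ℂ}
    {ρ : ℂ → ℝ} (h : IsLocalDefiningFunction D p ρ) :
    ∃ V : Set ℂ, IsOpen V ∧ p ∈ V ∧ ∀ f : ℂ → ℂ, ContDiff ℝ 1 f → HasCompactSupport f →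
      tsupport f ⊆ V → HasGreenFormula D f := by
  obtain ⟨c, g, hg, V, hV, hpV, hDV, hτ⟩ := h.exists_graphHomeomorph
  refine ⟨V, hV, hpV, fun f hf hfc hfV => ?_⟩
  set Φ := graphHomeomorph hg.continuous p c with hΦ
  set S := Φ '' (univ ×ˢ Iio 0) with hS
  set γ : ℝ → ℂ := fun x => Φ (x, 0) with hγ
  have hSV : ∀ z ∈ V, z ∈ D ↔ z ∈ S := fun z hz => by
    have := hDV (Φ.symm z) (by simpa using hz)
    rw [Φ.apply_symm_apply] at this
    rw [this, hS, mem_image_graphHomeomorph_iff]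
  have hfrS : frontier S = range γ := by
    rw [hS, ← Φ.image_frontier, frontier_univ_prod_eq, frontier_Iio]
    ext z; simp [hγ]
  have hfr : ∀ z ∈ V, z ∈ frontier D ↔ z ∈ range γ := fun z hz => by
    have h1 : D ∩ V = S ∩ V := by
      ext w; exact and_congr_left (hSV w)
    have h2 : frontier D ∩ V = frontier S ∩ V := by
      rw [← frontier_inter_open_inter hV, h1, frontier_inter_open_inter hV]
    have := congrArg (z ∈ ·) h2
    simpa [hz, hfrS] using this
  have hγd : ∀ x, HasDerivAt γ (c * (1 + Complex.I * (deriv g x : ℝ))) x := fun x =>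
    hasDerivAt_graph p c hg x 0
  have hγC : ContDiff ℝ 1 γ := (contDiff_graphHomeomorph p c hg).comp (by fun_prop)
  have hγe : MeasurableEmbedding γ :=
    hγC.continuous.measurableEmbedding (Φ.injective.comp fun x y hxy => by simpa using hxy)
  have hpt : ∀ x, ‖deriv γ x‖ • (f (γ x) * positiveUnitTangent D (γ x))
      = -(c * (1 + Complex.I * (deriv g x : ℝ))) * f (γ x) := fun x => by
    by_cases hx : γ x ∈ V
    · rw [(hγd x).deriv, ← mul_smul_comm, hτ x hx, mul_comm]
    · rw [image_eq_zero_of_notMem_tsupport fun hc => hx (hfV hc)]; simp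
  have hind1 : (frontier D).indicator (fun z => f z * positiveUnitTangent D z)
      = (range γ).indicator (fun z => f z * positiveUnitTangent D z) := by
    ext z
    by_cases hz : z ∈ V
    · classical
      rw [indicator_apply, indicator_apply]
      exact if_congr (hfr z hz) rfl rfl
    · have : f z = 0 := image_eq_zero_of_notMem_tsupport fun hc => hz (hfV hc)
      simp [indicator, this]
  have hind2 : D.indicator (dzStarDeriv f) = S.indicator (dzStarDeriv f) := by
    ext z
    by_cases hz : z ∈ V
    · classical
      rw [indicator_apply, indicator_apply]
      exact if_congr (hSV z hz) rfl rfl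
    · have : dzStarDeriv f z = 0 := dzStarDeriv_of_notMem_tsupport fun hc => hz (hfV hc)
      simp [indicator, this]
  have hSm : MeasurableSet S :=
    Φ.measurableEmbedding.measurableSet_image.2 (MeasurableSet.univ.prod measurableSet_Iio)
  have hfrm : MeasurableSet (frontier D) := isClosed_frontier.measurableSet
  refine ⟨?_, (integrable_dzStarDeriv hf hfc).integrableOn, ?_⟩
  · rw [← integrable_indicator_iff hfrm, hind1, integrable_indicator_iff hγe.measurableSet_range,
      integrableOn_range_hausdorffMeasure_iff hγC hγe]
    simp only [hpt]
    have h1 := hg.continuous_deriv le_rfl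
    have h2 := hf.continuous.comp hγC.continuous
    refine Continuous.integrable_of_hasCompactSupport ?_ (HasCompactSupport.mul_left ?_)
    · exact Continuous.mul (by fun_prop) h2
    · exact (hfc.comp_isClosedEmbedding Φ.isClosedEmbedding).comp_prodMk_left 0
  · rw [← integral_indicator hfrm, hind1, integral_indicator hγe.measurableSet_range,
      setIntegral_range_hausdorffMeasure hγC hγe, ← integral_indicator hD.measurableSet,
      hind2, integral_indicator hSm]
    have key := setIntegral_subgraph_dzStarDeriv p c hg hf hfc
    rw [integral_const_mul] at key
    rw [mul_right_comm, key, ← integral_mul_const]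
    refine integral_congr_ae (.of_forall fun x => ?_)
    simp only [hpt]
    -- The signs agree because `i (i - g') = -(1 + i g')`, the reversed velocity up to the factor
    -- `c`.
    linear_combination (c : ℂ) * f (γ x) * Complex.I_sq

/-! ### Global Green's formula by a partition of unity -/

theorem contDiff_mul_of_tsupport_subset {φ : ℂ → ℝ} {f : ℂ → ℂ} {Ω : Set ℂ} {n : WithTop ℕ∞}
    (hΩ : IsOpen Ω)
    (hφ : ContDiff ℝ n φ) (hf : ContDiffOn ℝ n f Ω) (hs : tsupport φ ⊆ Ω) :
    ContDiff ℝ n (fun z => (φ z : ℂ) * f z) := by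
  refine contDiff_iff_contDiffAt.2 fun z => ?_
  by_cases hz : z ∈ tsupport φ
  · exact (Complex.ofRealCLM.contDiff.comp hφ).contDiffAt.mul (hf.contDiffAt (hΩ.mem_nhds (hs hz)))
  · refine (contDiffAt_const (c := (0 : ℂ))).congr_of_eventuallyEq ?_
    filter_upwards [notMem_tsupport_iff_eventuallyEq.1 hz] with w hw
    simp [hw]

theorem tsupport_ofReal_mul_subset (φ : ℂ → ℝ) (f : ℂ → ℂ) :
    tsupport (fun z => (φ z : ℂ) * f z) ⊆ tsupport φ := by
  refine closure_mono fun z hz => ?_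
  intro hc
  exact hz (by simp [hc])

theorem dzStarDeriv_sum {ι : Type*} (s : Finset ι) {F : ι → ℂ → ℂ} {z : ℂ}
    (hF : ∀ i ∈ s, DifferentiableAt ℝ (F i) z) :
    dzStarDeriv (fun w => ∑ i ∈ s, F i w) z = ∑ i ∈ s, dzStarDeriv (F i) z := by
  simp only [dzStarDeriv, fderiv_fun_sum hF, _root_.sum_apply, Finset.mul_sum,
    ← Finset.sum_add_distrib, Finset.sum_div]

/-- Green's formula on a bounded open set with smooth boundary. -/
theorem HasSmoothBoundary.hasGreenFormula {D Ω : Set ℂ} (hbd : HasSmoothBoundary D) (hD : IsOpen D)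
    (hDc : IsCompact (closure D)) (hΩ : IsOpen Ω) (hDΩ : closure D ⊆ Ω) {f : ℂ → ℂ}
    (hf : ContDiffOn ℝ 1 f Ω) : HasGreenFormula D f := by
  have hloc : ∀ p ∈ closure D, ∃ V : Set ℂ, IsOpen V ∧ p ∈ V ∧ V ⊆ Ω ∧
      ∀ f : ℂ → ℂ, ContDiff ℝ 1 f → tsupport f ⊆ V → HasGreenFormula D f := by
    intro p hp
    obtain ⟨V, hV, hpV, H⟩ : ∃ V : Set ℂ, IsOpen V ∧ p ∈ V ∧ ∀ f : ℂ → ℂ, ContDiff ℝ 1 f →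
        HasCompactSupport f → tsupport f ⊆ V → HasGreenFormula D f := by
      by_cases hpD : p ∈ D
      · exact ⟨D, hD, hpD, fun f => hasGreenFormula_of_tsupport_subset hD⟩
      · obtain ⟨ρ, hρ⟩ := hbd p (by rw [hD.frontier_eq]; exact ⟨hp, hpD⟩)
        exact hρ.exists_hasGreenFormula hD
    -- Intersecting with `Ω` lets each localized piece of `f` extend by zero to a `C¹` function on
    -- the plane; intersecting with a ball makes its support compact.
    have hb : Bornology.IsBounded (V ∩ (Ω ∩ Metric.ball p 1)) :=
      Metric.isBounded_ball.subset (inter_subset_right.trans inter_subset_right)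
    refine ⟨V ∩ (Ω ∩ Metric.ball p 1), hV.inter (hΩ.inter Metric.isOpen_ball),
      ⟨hpV, hDΩ hp, Metric.mem_ball_self one_pos⟩, inter_subset_right.trans inter_subset_left,
      fun f hf hfV => H f hf ?_ (hfV.trans inter_subset_left)⟩
    exact Metric.isCompact_of_isClosed_isBounded (isClosed_tsupport f) (hb.subset hfV)
  choose! V hVo hpV hVΩ HV using hloc
  obtain ⟨t, htD, htc⟩ := hDc.elim_nhds_subcover V fun p hp => (hVo p hp).mem_nhds (hpV p hp)
  obtain ⟨φ, hφ⟩ := SmoothPartitionOfUnity.exists_isSubordinate (modelWithCornersSelf ℝ ℂ)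
    isClosed_closure (fun i : t => V i) (fun i => hVo i (htD i i.2)) (by
      rw [iUnion_subtype]; exact htc)
  set F : t → ℂ → ℂ := fun i z => (φ i z : ℂ) * f z with hFdef
  have hF : ∀ i, ContDiff ℝ 1 (F i) := fun i =>
    contDiff_mul_of_tsupport_subset hΩ ((φ i).contMDiff.contDiff.of_le (by simp)) hf
      ((hφ i).trans (hVΩ i (htD i i.2)))
  have hG : ∀ i, HasGreenFormula D (F i) := fun i =>
    HV i (htD i i.2) _ (hF i) ((tsupport_ofReal_mul_subset _ _).trans (hφ i))
  have hsum : ∀ z ∈ closure D, f z = ∑ i, F i z := fun z hz => by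
    have h1 := φ.sum_eq_one hz
    rw [finsum_eq_sum_of_fintype] at h1
    rw [hFdef, ← Finset.sum_mul, ← Complex.ofReal_sum, h1]; simp
  -- The partition sums to one only on `closure D`, but `D` is open, so the identity may be
  -- differentiated at its points.
  have hd : ∀ z ∈ D, dzStarDeriv f z = ∑ i, dzStarDeriv (F i) z := fun z hz => by
    rw [← dzStarDeriv_sum _ fun i _ => (hF i).differentiable one_ne_zero z]
    refine EventuallyEq.dzStarDeriv_eq ?_
    filter_upwards [hD.mem_nhds hz] with w hw using hsum w (subset_closure hw)
  have hb : ∀ z ∈ frontier D, f z * positiveUnitTangent D z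
      = ∑ i, F i z * positiveUnitTangent D z := fun z hz => by
    rw [hsum z (frontier_subset_closure hz), Finset.sum_mul]
  have hfrm : MeasurableSet (frontier D) := isClosed_frontier.measurableSet
  refine ⟨?_, ?_, ?_⟩
  · exact (integrableOn_congr_fun hb hfrm).2 (integrable_finsetSum _ fun i _ => (hG i).1)
  · exact (integrableOn_congr_fun hd hD.measurableSet).2
      (integrable_finsetSum _ fun i _ => (hG i).2.1)
  · rw [setIntegral_congr_fun hfrm hb, setIntegral_congr_fun hD.measurableSet hd,
      integral_finsetSum _ fun i _ => (hG i).1, integral_finsetSum _ fun i _ => (hG i).2.1,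
      Finset.mul_sum]
    exact Finset.sum_congr rfl fun i _ => (hG i).2.2

/-! ### The Cauchy kernel in polar coordinates -/

theorem integrableOn_polarCoord_target {H : ℝ × ℝ → ℂ} (hH : Continuous H) {R : ℝ}
    (hR : ∀ q : ℝ × ℝ, R < q.1 → H q = 0) : IntegrableOn H polarCoord.target := by
  have h1 : IntegrableOn H (Icc 0 R ×ˢ Icc (-Real.pi) Real.pi) :=
    hH.continuousOn.integrableOn_compact (isCompact_Icc.prod isCompact_Icc)
  refine h1.of_forall_sdiff_eq_zero polarCoord.open_target.measurableSet fun q hq => hR q ?_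
  obtain ⟨⟨h2, h3⟩, h4⟩ := hq
  by_contra hc
  exact h4 ⟨⟨(mem_Ioi.1 h2).le, not_lt.1 hc⟩, h3.1.le, h3.2.le⟩

theorem Complex.polarCoord_symm_eq_mul_exp (q : ℝ × ℝ) :
    Complex.polarCoord.symm q = q.1 * (Circle.exp q.2 : ℂ) := by
  rw [Complex.polarCoord_symm_apply, Circle.coe_exp, Complex.exp_mul_I, Complex.ofReal_cos,
    Complex.ofReal_sin]

theorem smul_div_polarCoord_symm (h : ℂ → ℂ) {q : ℝ × ℝ} (hq : q ∈ polarCoord.target) :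
    q.1 • (h (Complex.polarCoord.symm q) / Complex.polarCoord.symm q)
      = h (q.1 * Circle.exp q.2) / Circle.exp q.2 := by
  have h1 : (q.1 : ℂ) ≠ 0 := by exact_mod_cast (mem_Ioi.1 hq.1).ne'
  have h2 : (Circle.exp q.2 : ℂ) ≠ 0 := Circle.coe_ne_zero _
  rw [Complex.polarCoord_symm_eq_mul_exp, Complex.real_smul]
  field_simp

theorem exists_forall_polar_eq_zero {h : ℂ → ℂ} (hc : HasCompactSupport h) :
    ∃ R : ℝ, ∀ q : ℝ × ℝ, R < q.1 → (q.1 * Circle.exp q.2 : ℂ) ∉ tsupport h := by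
  obtain ⟨R, hR⟩ := hc.isBounded.subset_closedBall 0
  refine ⟨R, fun q hq hm => ?_⟩
  have := mem_closedBall_zero_iff.1 (hR hm)
  rw [norm_mul, Circle.norm_coe, mul_one, Complex.norm_real, Real.norm_eq_abs] at this
  exact absurd ((le_abs_self _).trans this) (not_le.2 hq)

/-- The polar Jacobian `r` cancels the singularity `1 / |z|`, leaving a continuous function that
vanishes for large `r`. -/
theorem integrable_div_self {h : ℂ → ℂ} (hh : Continuous h) (hc : HasCompactSupport h) :
    Integrable (fun z => h z / z) := by
  refine ⟨(hh.measurable.div measurable_id).aestronglyMeasurable, ?_⟩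
  obtain ⟨R, hR⟩ := exists_forall_polar_eq_zero hc
  have hi : IntegrableOn (fun q : ℝ × ℝ => h (q.1 * Circle.exp q.2) / Circle.exp q.2)
      polarCoord.target := by
    refine integrableOn_polarCoord_target (R := R) ?_ fun q hq => ?_
    · exact (hh.comp (by fun_prop)).div (by fun_prop) fun q => Circle.coe_ne_zero _
    · rw [image_eq_zero_of_notMem_tsupport (hR q hq), zero_div]
  rw [HasFiniteIntegral, ← Complex.lintegral_comp_polarCoord_symm]
  refine lt_of_eq_of_lt (setLIntegral_congr_fun polarCoord.open_target.measurableSet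
    fun q hq => ?_) hi.2
  simp only
  rw [← smul_div_polarCoord_symm h hq, enorm_smul, Real.enorm_of_nonneg (mem_Ioi.1 hq.1).le]
  rfl

/-- With `2 ∂_{z*} = e^{iθ} (∂_r + (i / r) ∂_θ)`, the integrand times `r` is half of `∂_r v + (i /
r) ∂_θ v`. Each ray contributes `-v 0` to the first term, giving `-2π v 0` in all; the second term
vanishes on each circle. -/
theorem integral_dzStarDeriv_div_self {v : ℂ → ℂ} (hv : ContDiff ℝ 1 v)
    (hc : HasCompactSupport v) : ∫ z, dzStarDeriv v z / z = -(Real.pi * v 0) := by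
  obtain ⟨R, hR⟩ := exists_forall_polar_eq_zero hc
  have hfd : Continuous fun q : ℝ × ℝ => fderiv ℝ v (q.1 * Circle.exp q.2) :=
    (hv.continuous_fderiv one_ne_zero).comp (by fun_prop)
  have hfd0 : ∀ q : ℝ × ℝ, R < q.1 → fderiv ℝ v (q.1 * Circle.exp q.2) = 0 := fun q hq =>
    image_eq_zero_of_notMem_tsupport fun hm => hR q hq (tsupport_fderiv_subset ℝ hm)
  have hi1 : IntegrableOn (fun q : ℝ × ℝ => fderiv ℝ v (q.1 * Circle.exp q.2) (Circle.exp q.2))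
      polarCoord.target :=
    integrableOn_polarCoord_target (R := R) (hfd.clm_apply (by fun_prop))
      fun q hq => by rw [hfd0 q hq]; rfl
  have hi2 : IntegrableOn (fun q : ℝ × ℝ =>
      fderiv ℝ v (q.1 * Circle.exp q.2) (Circle.exp q.2 * Complex.I)) polarCoord.target :=
    integrableOn_polarCoord_target (R := R) (hfd.clm_apply (by fun_prop))
      fun q hq => by rw [hfd0 q hq]; rfl
  have hres : (volume : Measure (ℝ × ℝ)).restrict polarCoord.target
      = (volume.restrict (Ioi 0)).prod (volume.restrict (Ioo (-Real.pi) Real.pi)) := by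
    rw [Measure.prod_restrict, ← Measure.volume_eq_prod]; rfl
  have hrad : ∫ q in polarCoord.target, fderiv ℝ v (q.1 * Circle.exp q.2) (Circle.exp q.2)
      = -(2 * Real.pi * v 0) := by
    rw [IntegrableOn, hres] at hi1
    rw [hres, integral_prod_symm _ hi1]
    have : ∀ θ : ℝ, ∫ r in Ioi (0 : ℝ), fderiv ℝ v (r * Circle.exp θ) (Circle.exp θ) = -v 0 := by
      intro θ
      have hd : ∀ r : ℝ, HasDerivAt (fun r : ℝ => v (r * Circle.exp θ))
          (fderiv ℝ v (r * Circle.exp θ) (Circle.exp θ)) r := fun r =>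
        (hv.differentiable one_ne_zero _).hasFDerivAt.comp_hasDerivAt r
          (by simpa using (hasDerivAt_id r).ofReal_comp.mul_const (Circle.exp θ : ℂ))
      have hC : ContDiff ℝ 1 (fun r : ℝ => v (r * Circle.exp θ)) :=
        hv.comp (Complex.ofRealCLM.contDiff.mul contDiff_const)
      have hs : HasCompactSupport (fun r : ℝ => v (r * Circle.exp θ)) := by
        have he : Isometry (fun r : ℝ => (r * Circle.exp θ : ℂ)) := by
          refine Isometry.of_dist_eq fun a b => ?_
          rw [dist_eq_norm, ← sub_mul, norm_mul, Circle.norm_coe, mul_one, ← Complex.ofReal_sub,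
            Complex.norm_real, dist_eq_norm]
        exact hc.comp_isClosedEmbedding he.isClosedEmbedding
      have h1 := hs.integral_Ioi_deriv_eq hC 0
      simp only [fun r => (hd r).deriv] at h1
      simpa using h1
    simp only [this]
    simp [Real.pi_pos.le, ← two_mul, mul_assoc]
  have hang : ∫ q in polarCoord.target,
      fderiv ℝ v (q.1 * Circle.exp q.2) (Circle.exp q.2 * Complex.I) = 0 := by
    rw [IntegrableOn, hres] at hi2
    rw [hres, integral_prod _ hi2]
    refine setIntegral_eq_zero_of_forall_eq_zero fun r hr => ?_
    have hr0 : (r : ℂ) ≠ 0 := by exact_mod_cast (mem_Ioi.1 hr).ne'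
    have hd : ∀ θ : ℝ, HasDerivAt (fun θ : ℝ => v (r * Circle.exp θ))
        (r * fderiv ℝ v (r * Circle.exp θ) (Circle.exp θ * Complex.I)) θ := fun θ => by
      have e1 : HasDerivAt (fun θ : ℝ => (r * Circle.exp θ : ℂ))
          (r • (Circle.exp θ * Complex.I)) θ := by
        simp only [Circle.coe_exp, Complex.real_smul]
        simpa using (((hasDerivAt_id θ).ofReal_comp.mul_const Complex.I).cexp).const_mul (r : ℂ)
      have e2 := (hv.differentiable one_ne_zero (r * Circle.exp θ)).hasFDerivAt.comp_hasDerivAt θ e1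
      rwa [map_smul, Complex.real_smul] at e2
    have hcont : Continuous fun θ : ℝ =>
        r * fderiv ℝ v (r * Circle.exp θ) (Circle.exp θ * Complex.I) :=
      continuous_const.mul ((hfd.comp (by fun_prop : Continuous fun θ : ℝ => (r, θ))).clm_apply
        (by fun_prop))
    have h1 := intervalIntegral.integral_eq_sub_of_hasDerivAt (a := -Real.pi) (b := Real.pi)
      (fun θ _ => hd θ) (hcont.intervalIntegrable _ _)
    have h2 : (Circle.exp Real.pi : ℂ) = Circle.exp (-Real.pi) := by
      simp [Circle.coe_exp]
    rw [h2, sub_self, intervalIntegral.integral_of_le (by linarith [Real.pi_pos]),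
      integral_Ioc_eq_integral_Ioo, integral_const_mul] at h1
    exact (mul_eq_zero.1 h1).resolve_left hr0
  rw [← Complex.integral_comp_polarCoord_symm, setIntegral_congr_fun
    polarCoord.open_target.measurableSet fun q hq => smul_div_polarCoord_symm (dzStarDeriv v) hq]
  have hpt : ∀ q : ℝ × ℝ, dzStarDeriv v (q.1 * Circle.exp q.2) / Circle.exp q.2
      = (1 / 2) * (fderiv ℝ v (q.1 * Circle.exp q.2) (Circle.exp q.2) + Complex.I *
        fderiv ℝ v (q.1 * Circle.exp q.2) (Circle.exp q.2 * Complex.I)) := fun q => by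
    rw [div_eq_iff (Circle.coe_ne_zero _)]
    linear_combination (1 / 2) * two_mul_dzStarDeriv_eq (Circle.exp q.2) v (q.1 * Circle.exp q.2)
  simp only [hpt]
  rw [integral_const_mul, integral_add hi1 (hi2.const_mul _), integral_const_mul, hrad, hang]
  ring

theorem integrable_div_sub {h : ℂ → ℂ} (hh : Continuous h) (hc : HasCompactSupport h) (lam : ℂ) :
    Integrable (fun z => h z / (z - lam)) := by
  have := (integrable_div_self (h := fun z => h (z + lam)) (by fun_prop)
    (hc.comp_isClosedEmbedding (Homeomorph.addRight lam).isClosedEmbedding)).comp_sub_right lam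
  simpa using this

/-- The Cauchy–Pompeiu formula for a compactly supported function. -/
theorem integral_dzStarDeriv_div_sub {v : ℂ → ℂ} (hv : ContDiff ℝ 1 v)
    (hc : HasCompactSupport v) (lam : ℂ) :
    ∫ z, dzStarDeriv v z / (z - lam) = -(Real.pi * v lam) := by
  have h1 := integral_dzStarDeriv_div_self (v := fun z => v (z + lam))
    (hv.comp (contDiff_id.add contDiff_const))
    (hc.comp_isClosedEmbedding (Homeomorph.addRight lam).isClosedEmbedding)
  have h2 : ∀ z, dzStarDeriv (fun z => v (z + lam)) z = dzStarDeriv v (z + lam) := fun z => by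
    simp only [dzStarDeriv, fderiv_comp_add_right]
  simp only [h2, zero_add] at h1
  rw [← h1, ← integral_add_right_eq_self _ lam]
  simp

/-! ### The Cauchy–Pompeiu formula -/

/-- The factor `1 / (w - lam)` is holomorphic away from `lam`, so `∂_{z*}` passes over it. -/
theorem dzStarDeriv_div_sub {h : ℂ → ℂ} {z lam : ℂ} (hh : DifferentiableAt ℝ h z)
    (hz : z ≠ lam) : dzStarDeriv (fun w => h w / (w - lam)) z = dzStarDeriv h z / (z - lam) := by
  have hz' : z - lam ≠ 0 := sub_ne_zero.2 hz
  have h1 : HasDerivAt (fun w => (w - lam)⁻¹) (-1 / (z - lam) ^ 2) z :=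
    ((hasDerivAt_id z).sub_const lam).inv hz'
  have h2 := hh.hasFDerivAt.mul (h1.hasFDerivAt.restrictScalars ℝ)
  have h3 : fderiv ℝ (fun w => h w / (w - lam)) z = _ := h2.fderiv
  rw [dzStarDeriv, h3, dzStarDeriv]
  simp
  field_simp
  linear_combination (-(h z)) * Complex.I_sq

theorem dzStarDeriv_add {f g : ℂ → ℂ} {z : ℂ} (hf : DifferentiableAt ℝ f z)
    (hg : DifferentiableAt ℝ g z) :
    dzStarDeriv (fun w => f w + g w) z = dzStarDeriv f z + dzStarDeriv g z := by
  simp only [dzStarDeriv, fderiv_fun_add hf hg, _root_.add_apply]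
  ring

theorem wedgeProd_formDzStar_formDz : wedgeProd formDzStar formDz 1 Complex.I = 2 * Complex.I := by
  simp [wedgeProd, formDzStar, formDz]
  ring

theorem mainTheorem5 (Ω D : Set ℂ) (u : ℂ → ℂ)
    (hΩ : IsOpen Ω) (hΩc : IsCompact (closure Ω)) (hu : ContDiffOn ℝ ∞ u Ω)
    (hD : IsOpen D) (hDΩ : D ⊆ Ω) (hbd : HasSmoothBoundary D) (hfr : frontier D ⊆ Ω)
    (lam : ℂ) (hlam : lam ∈ D) :
    IntegrableOn (fun z => ((u z / (z - lam)) • formDz) (positiveUnitTangent D z)) (frontier D)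
      (Measure.hausdorffMeasure 1) ∧
    IntegrableOn (fun z => dzStarDeriv u z / (z - lam)) D volume ∧
    u lam = 1 / (2 * Real.pi * Complex.I) *
          boundaryIntegral D (fun z => (u z / (z - lam)) • formDz)
        - 1 / (2 * Real.pi * Complex.I) *
          areaIntegral D (fun z v w =>
            dzStarDeriv u z / (z - lam) * wedgeProd formDzStar formDz v w) ∧
    u lam = 1 / (2 * Real.pi * Complex.I) *
          boundaryIntegral D (fun z => (u z / (z - lam)) • formDz)
        - 1 / Real.pi * ∫ z in D, dzStarDeriv u z / (z - lam) := by
  have hu1 : ContDiffOn ℝ 1 u Ω := hu.of_le (by simp)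
  have hDc : IsCompact (closure D) := hΩc.of_isClosed_subset isClosed_closure (closure_mono hDΩ)
  have hDΩ' : closure D ⊆ Ω := by
    rw [closure_eq_self_union_frontier]; exact union_subset hDΩ hfr
  obtain ⟨r, hr, hrD⟩ := Metric.nhds_basis_closedBall.mem_iff.1 (hD.mem_nhds hlam)
  let χ : ContDiffBump lam := ⟨r / 2, r, by positivity, by linarith⟩
  have hχD : tsupport χ ⊆ D := by rw [χ.tsupport_eq]; exact hrD
  have hχ1 : ∀ᶠ z in 𝓝 lam, χ z = 1 := χ.eventuallyEq_one
  set v : ℂ → ℂ := fun z => (χ z : ℂ) * u z with hv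
  set f : ℂ → ℂ := fun z => ((1 - χ z : ℝ) : ℂ) * u z / (z - lam) with hf
  have hvC : ContDiff ℝ 1 v :=
    contDiff_mul_of_tsupport_subset hΩ χ.contDiff hu1 (hχD.trans hDΩ)
  have hvc : HasCompactSupport v :=
    χ.hasCompactSupport.of_isClosed_subset (isClosed_tsupport _) (tsupport_ofReal_mul_subset _ _)
  have hvl : v lam = u lam := by simp [hv, hχ1.self_of_nhds]
  have hf0 : f =ᶠ[𝓝 lam] fun _ => 0 := by
    filter_upwards [hχ1] with z hz
    simp [hf, hz]
  have hnum : ContDiffOn ℝ 1 (fun z => ((1 - χ z : ℝ) : ℂ) * u z) Ω :=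
    (Complex.ofRealCLM.contDiff.comp (contDiff_const.sub χ.contDiff)).contDiffOn.mul hu1
  have hfC : ContDiffOn ℝ 1 f Ω := fun z hz => by
    rcases eq_or_ne z lam with rfl | hzl
    · exact (contDiffAt_const.congr_of_eventuallyEq hf0).contDiffWithinAt
    · simp only [hf, div_eq_mul_inv]
      exact (hnum z hz).mul
        ((contDiffWithinAt_id.sub contDiffWithinAt_const).inv (sub_ne_zero.2 hzl))
  obtain ⟨hG1, hG2, hG3⟩ := hbd.hasGreenFormula hD hDc hΩ hDΩ' hfC
  have hfrm : MeasurableSet (frontier D) := isClosed_frontier.measurableSet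
  have hb : ∀ z ∈ frontier D, ((u z / (z - lam)) • formDz) (positiveUnitTangent D z)
      = f z * positiveUnitTangent D z := fun z hz => by
    rw [hD.frontier_eq] at hz
    have h1 : χ z = 0 := image_eq_zero_of_notMem_tsupport fun hc => hz.2 (hχD hc)
    simp [hf, h1, formDz]
  have ha : ∀ z ∈ D, dzStarDeriv u z / (z - lam)
      = dzStarDeriv v z / (z - lam) + dzStarDeriv f z := fun z hz => by
    rcases eq_or_ne z lam with rfl | hzl
    -- At the pole division by zero gives `0` for both quotients, and `f` vanishes nearby, so the
    -- identity holds there too.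
    · rw [hf0.dzStarDeriv_eq]; simp [dzStarDeriv]
    · have hd := ((hnum.contDiffAt (hΩ.mem_nhds (hDΩ hz))).differentiableAt one_ne_zero)
      have h1 : u = fun w => v w + ((1 - χ w : ℝ) : ℂ) * u w := by
        funext w; simp only [hv]; push_cast; ring
      have h2 : dzStarDeriv u z = dzStarDeriv v z + _ :=
        (congrArg (dzStarDeriv · z) h1).trans
          (dzStarDeriv_add (hvC.differentiable one_ne_zero z) hd)
      rw [h2, hf, dzStarDeriv_div_sub hd hzl, add_div]
  have hvi : Integrable (fun z => dzStarDeriv v z / (z - lam)) :=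
    integrable_div_sub (continuous_dzStarDeriv hvC) (hasCompactSupport_dzStarDeriv hvc) lam
  have hB : boundaryIntegral D (fun z => (u z / (z - lam)) • formDz)
      = 2 * Complex.I * ∫ z in D, dzStarDeriv f z := by
    rw [hG3, boundaryIntegral, setIntegral_congr_fun hfrm hb]
  have hA : ∫ z in D, dzStarDeriv u z / (z - lam)
      = -(Real.pi * u lam) + ∫ z in D, dzStarDeriv f z := by
    rw [setIntegral_congr_fun hD.measurableSet ha, integral_add hvi.integrableOn hG2,
      setIntegral_eq_integral_of_forall_compl_eq_zero, integral_dzStarDeriv_div_sub hvC hvc, hvl]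
    intro z hz
    rw [dzStarDeriv_of_notMem_tsupport, zero_div]
    exact fun hc => hz (hχD (tsupport_ofReal_mul_subset _ _ hc))
  have hpi : (Real.pi : ℂ) ≠ 0 := by exact_mod_cast Real.pi_ne_zero
  have hmain : u lam = 1 / (2 * Real.pi * Complex.I) *
      boundaryIntegral D (fun z => (u z / (z - lam)) • formDz)
        - 1 / Real.pi * ∫ z in D, dzStarDeriv u z / (z - lam) := by
    rw [hB, hA]
    field_simp
    ring
  refine ⟨(integrableOn_congr_fun hb hfrm).2 hG1, (integrableOn_congr_fun ha hD.measurableSet).2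
    (hvi.integrableOn.add hG2), ?_, hmain⟩
  -- Since `dz* ∧ dz = 2i dx ∧ dy`, the factor `1 / (2πi)` becomes `1 / π`.
  rw [areaIntegral, wedgeProd_formDzStar_formDz, integral_mul_const]
  conv_lhs => rw [hmain]
  field_simp
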